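/- For natural numbers $k$ and $m \ge 1$ let $\mathrm{M}(k,m)=\frac1m\sum_{d\mid m}\mu\!\left(\frac md\right)k^d$ be the value of the necklace polynomial, where $\mu$ is the Möbius function. A cyclic two-dimensional array of shape $(M,N)$ (row indices are read modulo $M$ and column indices modulo $N$), with letters from a finite alphabet of size $K$, is called an $(M,N;\,m,n)_K$-sub-perfect map if every $m\times n$ pattern of letters occurs at most once in it, that is, for at most one of the $MN$ possible positions of its upper left corner. Theorem. Let $k\ge 2$ be an integer and let $p$ be a prime. Then, over every alphabet of size $k^2$, there exists an $(N,N;\,p,p)_{k^2}$-sub-perfect map with \[ N=p\cdot\bigl(\mathrm{M}(k^p,p)-1\bigr)=k^{p^2}-k^p-p. \] -/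

import Mathlib

/-- The value `M(k, m) = (1/m) * ∑_{d ∣ m} μ(m/d) * k^d` of the necklace polynomial (for `m ≥ 1`),
as a rational number. -/
def necklaceM (k m : ℕ) : ℚ :=
  (1 / (m : ℚ)) * ∑ d ∈ m.divisors, (ArithmeticFunction.moebius (m / d) : ℚ) * (k : ℚ) ^ d

/-- Moving `a` steps forward from position `i` on a cycle of length `M`. -/
def cyclicStep {M : ℕ} (i : Fin M) (a : ℕ) : Fin M :=
  ⟨((i : ℕ) + a) % M, Nat.mod_lt _ (Nat.lt_of_le_of_lt (Nat.zero_le _) i.isLt)⟩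

/-- The pattern `P` of shape `(m, n)` occurs in the cyclic array `A` of shape `(M, N)` with its
upper left corner at the position `pos`; row and column indices of `A` wrap around. -/
def OccursAt {M N m n : ℕ} {Γ : Type*} (A : Matrix (Fin M) (Fin N) Γ)
    (P : Matrix (Fin m) (Fin n) Γ) (pos : Fin M × Fin N) : Prop :=
  ∀ (a : Fin m) (b : Fin n), A (cyclicStep pos.1 a) (cyclicStep pos.2 b) = P a b

/-- The cyclic array `A` of shape `(M, N)` over the finite alphabet `Γ` is an
`(M, N; m, n)_k`-sub-perfect map: the alphabet has exactly `k` letters, and every pattern of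
shape `(m, n)` occurs at no more than one position of `A`. -/
def IsSubPerfectMap (M N m n k : ℕ) {Γ : Type*} [Fintype Γ] (A : Matrix (Fin M) (Fin N) Γ) :
    Prop :=
  Fintype.card Γ = k ∧
    ∀ P : Matrix (Fin m) (Fin n) Γ, {pos : Fin M × Fin N | OccursAt A P pos}.Subsingleton

/-! Suppose a strip `T` with p cyclic rows and n cyclic columns over k letters has all its p × p
windows distinct, where n = M(k^p, p) − 1 ≡ −1 mod p (`exists_strip`). As p and n are coprime, the
array of pairs (T(i, j), T(j, i)) of side pn works: a p × p window determines i mod p, j mod n, j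
mod p and i mod n, hence its position by the Chinese remainder theorem.

The strip is a de Bruijn-type cycle through the p × p squares up to simultaneous rotation of the
columns. Squares with all columns constant are dropped, as rotation does not act freely on them;
dropping one more orbit, the loops, makes n prime to p. Cycle joining (`exists_joined_perm`,
`connected`) yields a single cycle through the remaining classes. One turn around it may accumulate
a rotation c; shearing column j by c·j cancels it because n ≡ −1 mod p. -/

/-! ### Cycle joining for permutations. -/

open Equiv Equiv.Perm in
theorem Equiv.Perm.SameCycle.of_mul_swap {E : Type*} [Finite E] [DecidableEq E] {π : Equiv.Perm E}
    {x y z : E} (hxy : ¬ π.SameCycle x y) (hz : π.SameCycle x z ∨ π.SameCycle y z) :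
    (π * Equiv.swap x y).SameCycle x z := by
  have closed : ∀ u, (π * swap x y).SameCycle x u →
      (π * swap x y).SameCycle x ((π * swap x y) u) := fun u hu =>
    sameCycle_apply_right.2 hu
  have hx : (π * swap x y) x = π y := by simp
  have hy : (π * swap x y) y = π x := by simp
  -- The new permutation sends x to π y, follows the old cycle of y up to y, then jumps to π x.
  have reach : ∀ m : ℕ, (π * swap x y).SameCycle x ((π ^ m) (π y)) := by
    intro m
    induction m with
    | zero => simpa only [pow_zero, one_apply, hx] using closed x (SameCycle.refl _ _)
    | succ m ih =>
      rw [pow_succ', mul_apply]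
      by_cases h1 : (π ^ m) (π y) = x
      · refine absurd ?_ hxy
        exact SameCycle.symm ⟨(m + 1 : ℕ), by rw [zpow_natCast, pow_succ, mul_apply, h1]⟩
      by_cases h2 : (π ^ m) (π y) = y
      · rw [h2, ← hx]
        exact closed x (SameCycle.refl _ _)
      · have := closed _ ih
        rwa [mul_apply, swap_apply_of_ne_of_ne h1 h2] at this
  have hy' : ∀ u, π.SameCycle y u → (π * swap x y).SameCycle x u := by
    intro u hu
    obtain ⟨m, hm⟩ := (sameCycle_apply_left.2 hu).exists_nat_pow_eq
    exact hm ▸ reach m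
  have reach' : ∀ m : ℕ, (π * swap x y).SameCycle x ((π ^ m) (π x)) := by
    intro m
    induction m with
    | zero => simpa only [pow_zero, one_apply, hy] using closed y (hy' y (SameCycle.refl _ _))
    | succ m ih =>
      rw [pow_succ', mul_apply]
      by_cases h1 : (π ^ m) (π x) = y
      · refine absurd ?_ hxy
        exact ⟨(m + 1 : ℕ), by rw [zpow_natCast, pow_succ, mul_apply, h1]⟩
      by_cases h2 : (π ^ m) (π x) = x
      · rw [h2, ← hy]
        exact closed y (hy' y (SameCycle.refl _ _))
      · have := closed _ ih
        rwa [mul_apply, swap_apply_of_ne_of_ne h2 h1] at this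
  rcases hz with hz | hz
  · obtain ⟨m, hm⟩ := (sameCycle_apply_left.2 hz).exists_nat_pow_eq
    exact hm ▸ reach' m
  · exact hy' z hz

/-- Cycle joining: a permutation can be composed with one preserving the fibres of `h` so that
a single cycle remains, provided that its cycles are connected through the fibres of `h`. -/
theorem exists_joined_perm {E V : Type*} [Finite E] (h : E → V) (π₀ : Equiv.Perm E)
    (hconn : ∀ S : Set E, S.Nonempty → (∀ x ∈ S, π₀ x ∈ S) →
      (∀ x ∈ S, ∀ y, h x = h y → y ∈ S) → S = Set.univ) :
    ∃ τ : Equiv.Perm E, (∀ x, h (τ x) = h x) ∧ ∀ x y, (π₀ * τ).SameCycle x y := by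
  classical
  rcases isEmpty_or_nonempty E with hE | ⟨⟨e⟩⟩
  · exact ⟨1, fun x => rfl, fun x => hE.elim x⟩
  let F := {τ : Equiv.Perm E // ∀ x, h (τ x) = h x}
  have : Nonempty F := ⟨⟨1, fun x => rfl⟩⟩
  -- Take the cycle of e as large as possible: if it met a fibre without containing it, a
  -- transposition inside the fibre would merge another cycle into it.
  obtain ⟨⟨τ, hτ⟩, hmax⟩ :=
    Finite.exists_max (fun τ : F => {y | (π₀ * τ.1).SameCycle e y}.ncard)
  refine ⟨τ, hτ, ?_⟩
  set π := π₀ * τ with hπ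
  have hfib : ∀ x, π.SameCycle e x → ∀ y, h x = h y → π.SameCycle e y := by
    intro x hx y hxy
    by_contra hy
    have hnot : ¬ π.SameCycle x y := fun hc => hy (hx.trans hc)
    have hmem : ∀ z, π.SameCycle x z ∨ π.SameCycle y z →
        (π * Equiv.swap x y).SameCycle x z := fun z => Equiv.Perm.SameCycle.of_mul_swap hnot
    have hxe := hmem e (Or.inl hx.symm)
    have hle := hmax ⟨τ * Equiv.swap x y, fun z => by
      rw [Equiv.Perm.mul_apply, hτ]
      rcases eq_or_ne z x with rfl | h1
      · simp [hxy]
      rcases eq_or_ne z y with rfl | h2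
      · simp [hxy]
      · rw [Equiv.swap_apply_of_ne_of_ne h1 h2]⟩
    refine absurd hle (not_le.2 (Set.ncard_lt_ncard ?_ (Set.toFinite _)))
    simp only [← mul_assoc]
    refine (Set.ssubset_iff_of_subset fun z hz => ?_).2 ⟨y, ?_, hy⟩
    · exact hxe.symm.trans (hmem z (Or.inl (hx.symm.trans hz)))
    · exact hxe.symm.trans (hmem y (Or.inr (Equiv.Perm.SameCycle.refl _ _)))
  have huniv : {y | π.SameCycle e y} = Set.univ := by
    refine hconn _ ⟨e, Equiv.Perm.SameCycle.refl _ _⟩ (fun x hx => ?_) hfib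
    have h1 : π.SameCycle e (τ⁻¹ x) := hfib x hx _ (by rw [← hτ (τ⁻¹ x)]; simp)
    have h2 : π (τ⁻¹ x) = π₀ x := by simp [hπ]
    exact h2 ▸ Equiv.Perm.sameCycle_apply_right.2 h1
  intro x y
  have hx : x ∈ {y | π.SameCycle e y} := huniv ▸ Set.mem_univ x
  have hy : y ∈ {y | π.SameCycle e y} := huniv ▸ Set.mem_univ y
  exact Equiv.Perm.SameCycle.trans (Equiv.Perm.SameCycle.symm hx) hy

/-! ### Good squares: free rotation, counting, connectivity. -/

/-- Cyclic squares over `α`, given by their columns. -/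
abbrev CyclicSquare (p : ℕ) (α : Type*) := ZMod p → ZMod p → α

namespace CyclicSquare

variable {p : ℕ} {α : Type*}

/-- Rotation of all columns by `r`. -/
def rot (r : ZMod p) (W : CyclicSquare p α) : CyclicSquare p α := fun b a => W b (a + r)

/-- The squares all of whose columns are constant. -/
def fixed (p : ℕ) (α : Type*) : Set (CyclicSquare p α) :=
  Set.range fun (f : ZMod p → α) (b _ : ZMod p) => f b

/-- The squares all of whose columns are equal to the same rotation of `v`. -/
def loops (v : ZMod p → α) : Set (CyclicSquare p α) :=
  Set.range fun (r _ a : ZMod p) => v (a + r)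

/-- The squares which are neither fixed by the rotations nor loops of `v`. -/
def good (v : ZMod p → α) : Set (CyclicSquare p α) := (fixed p α ∪ loops v)ᶜ

@[simp] theorem rot_zero (W : CyclicSquare p α) : rot 0 W = W := by
  funext b a; simp [rot]

@[simp] theorem rot_rot (r s : ZMod p) (W : CyclicSquare p α) :
    rot r (rot s W) = rot (r + s) W := by
  funext b a; simp [rot, add_assoc]

theorem mem_good_of_ne {v : ZMod p → α} {W : CyclicSquare p α} {b b' b'' a a' : ZMod p}
    (h : W b a ≠ W b a') (h' : W b' ≠ W b'') : W ∈ good v := by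
  rintro (⟨f, rfl⟩ | ⟨r, rfl⟩)
  · exact h rfl
  · exact h' rfl

theorem exists_ne_of_mem_good {v : ZMod p → α} {W : CyclicSquare p α} (h : W ∈ good v) :
    ∃ b a a', W b a ≠ W b a' := by
  by_contra! hc
  exact h (Or.inl ⟨fun b => W b 0, by funext b a; exact hc b 0 a⟩)

theorem rot_mem_good {v : ZMod p → α} {W : CyclicSquare p α} (h : W ∈ good v) (r : ZMod p) :
    rot r W ∈ good v := by
  rintro (⟨f, hf⟩ | ⟨s, hs⟩)
  · refine h (Or.inl ⟨f, ?_⟩)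
    have := (congrArg (rot (-r)) hf).trans (rot_rot (-r) r W)
    rwa [neg_add_cancel, rot_zero] at this
  · refine h (Or.inr ⟨s - r, ?_⟩)
    funext b a
    have := congrFun (congrFun hs b) (a - r)
    simp only [rot, sub_add_cancel] at this
    rw [← this]; ring_nf

theorem shift_mem_good {v : ZMod p → α} {W : CyclicSquare p α} (h : W ∈ good v) (i : ZMod p) :
    (fun b => W (b + i)) ∈ good v := by
  rintro (⟨f, hf⟩ | ⟨s, hs⟩)
  · refine h (Or.inl ⟨fun b => f (b - i), ?_⟩)
    funext b a
    simpa using congrFun (congrFun hf (b - i)) a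
  · refine h (Or.inr ⟨s, ?_⟩)
    funext b a
    simpa using congrFun (congrFun hs (b - i)) a

/-- As p is prime, a nonzero rotation generates all of them, so a square fixed by it has constant
columns. -/
theorem eq_of_rot_eq [Fact p.Prime] {v : ZMod p → α} {W : CyclicSquare p α} (h : W ∈ good v)
    {r s : ZMod p} (hrs : rot r W = rot s W) : r = s := by
  by_contra hne
  have h0 : r - s ≠ 0 := sub_ne_zero.2 hne
  have h1 : rot (r - s) W = W := by
    have := congrArg (rot (-s)) hrs
    rw [rot_rot, rot_rot, neg_add_cancel, rot_zero] at this
    rwa [sub_eq_neg_add]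
  have h2 : ∀ m : ℕ, rot ((m : ZMod p) * (r - s)) W = W := by
    intro m
    induction m with
    | zero => simp
    | succ m ih => rw [Nat.cast_succ, add_mul, one_mul, ← rot_rot, h1, ih]
  have h3 : ∀ t, rot t W = W := fun t => by
    have := h2 (t * (r - s)⁻¹).val
    rwa [ZMod.natCast_zmod_val, mul_assoc, inv_mul_cancel₀ h0, mul_one] at this
  refine h (Or.inl ⟨fun b => W b 0, ?_⟩)
  funext b a
  simpa [rot] using (congrFun (congrFun (h3 a) b) 0).symm

section Card

variable [Fact p.Prime]

/-- The indicator function of `0`, with values `x` at `0` and `y` elsewhere. -/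
def peak (p : ℕ) (x y : α) : ZMod p → α := fun a => if a = 0 then x else y

theorem peak_ne {x y : α} (hxy : x ≠ y) : peak p x y 0 ≠ peak p x y 1 := by simp [peak, hxy]

theorem loops_injective {x y : α} (hxy : x ≠ y) :
    Function.Injective fun (r : ZMod p) (_ : ZMod p) a => peak p x y (a + r) := by
  intro r s h
  have := congrFun (congrFun h 0) (-r)
  by_contra hne
  have h1 : -r + s ≠ 0 := fun h0 => hne (neg_add_eq_zero.1 h0)
  simp [peak, h1, hxy] at this

theorem ncard_good [Fintype α] {x y : α} (hxy : x ≠ y) :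
    (good (peak p x y)).ncard + Fintype.card α ^ p + p = Fintype.card α ^ p ^ 2 := by
  classical
  have hdisj : Disjoint (fixed p α) (loops (peak p x y)) := by
    rw [Set.disjoint_left]
    rintro _ ⟨f, rfl⟩ ⟨r, hr⟩
    have h1 := congrFun (congrFun hr 0) (-r)
    have h2 := congrFun (congrFun hr 0) (1 - r)
    refine peak_ne (p := p) hxy ?_
    simp only [neg_add_cancel, sub_add_cancel] at h1 h2
    rw [h1, h2]
  have hf : (fixed p α).ncard = Fintype.card α ^ p := by
    rw [fixed, ← Set.image_univ, Set.ncard_image_of_injective, Set.ncard_univ]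
    · simp [Nat.card_eq_fintype_card]
    · intro f g h
      funext b
      exact congrFun (congrFun h b) 0
  have hl : (loops (peak p x y)).ncard = p := by
    rw [loops, ← Set.image_univ, Set.ncard_image_of_injective _ (loops_injective hxy),
      Set.ncard_univ]
    simp
  have := Set.ncard_add_ncard_compl (fixed p α ∪ loops (peak p x y))
  rw [Set.ncard_union_eq hdisj, hf, hl] at this
  rw [good, add_assoc, add_comm, this, Nat.card_eq_fintype_card]
  simp [← pow_mul, sq]

end Card

/-- Keep a nonconstant column i, overwrite the others one by one with the constant x, then put the
peak in column i. Each intermediate square is good: column i is nonconstant and differs from an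
overwritten column. -/
theorem connected [Fact p.Prime] {x y : α} (hxy : x ≠ y) {S : Set (CyclicSquare p α)}
    (hS : S ⊆ good (peak p x y)) (hshift : ∀ W ∈ S, (fun b => W (b + 1)) ∈ S)
    (htail : ∀ W ∈ S, ∀ W' ∈ good (peak p x y), (∀ b ≠ 0, W b = W' b) → W' ∈ S)
    (hne : S.Nonempty) : Function.update (fun _ _ => x) 0 (peak p x y) ∈ S := by
  classical
  have hshiftn : ∀ m : ℕ, ∀ W ∈ S, (fun b => W (b + m)) ∈ S := by
    intro m
    induction m with
    | zero => simp
    | succ m ih =>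
      intro W hW
      have := hshift _ (ih W hW)
      simpa [add_assoc, add_comm (1 : ZMod p)] using this
  have hshifts : ∀ i : ZMod p, ∀ W ∈ S, (fun b => W (b + i)) ∈ S := fun i W hW => by
    simpa using hshiftn i.val W hW
  -- A shift brings column i to position 0, so any single column may be altered.
  have hcol : ∀ i, ∀ W ∈ S, ∀ W' ∈ good (peak p x y), (∀ b ≠ i, W b = W' b) → W' ∈ S := by
    intro i W hW W' hW' h
    have := htail _ (hshifts i W hW) _ (shift_mem_good hW' i)
      fun b hb => h (b + i) (by simpa using hb)
    simpa using hshifts (-i) _ this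
  obtain ⟨W, hW⟩ := hne
  obtain ⟨i, a, a', haa⟩ := exists_ne_of_mem_good (hS hW)
  have hmany : ∀ s : Finset (ZMod p), i ∉ s → (fun b => if b ∈ s then fun _ => x else W b) ∈ S := by
    intro s
    induction s using Finset.induction_on with
    | empty => simpa using hW
    | insert j s hj ih =>
      intro hi
      have hij : i ≠ j := fun h => hi (by simp [h])
      have his : i ∉ s := fun h => hi (by simp [h])
      refine hcol j _ (ih his) _ (mem_good_of_ne (b := i) (a := a) (a' := a') (b' := i) (b'' := j)
        (by simpa [hij, his] using haa) ?_) fun b hb => by simp [hb]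
      intro h
      have h1 := congrFun h a
      have h2 := congrFun h a'
      simp only [Finset.mem_insert, hij, his, or_self, if_false, true_or, if_true] at h1 h2
      exact haa (h1.trans h2.symm)
  have hcon : ∀ i : ZMod p, Function.update (fun _ _ => x) i (peak p x y) ∈ good (peak p x y) := by
    intro i
    refine mem_good_of_ne (b := i) (a := 0) (a' := 1) (b' := i) (b'' := i + 1) ?_ ?_
    · simpa using peak_ne hxy
    · intro h
      have := congrFun h 1
      simp [peak, hxy.symm] at this
  have h1 : Function.update (fun _ _ => x) i (peak p x y) ∈ S := by
    refine hcol i _ (hmany (Finset.univ.erase i) (by simp)) _ (hcon i) fun b hb => ?_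
    simp [hb]
  have h2 := hshifts i _ h1
  convert h2 using 1
  funext b
  by_cases hb : b = 0 <;> simp [hb]

end CyclicSquare

/-! ### Rotation classes and a single cycle through them. -/

namespace CyclicSquare

variable {p : ℕ} {α : Type*}

/-- Good squares up to rotation. -/
def rotSetoid (v : ZMod p → α) : Setoid (good v) where
  r W W' := ∃ r, rot r W.1 = W'.1
  iseqv :=
    ⟨fun W => ⟨0, rot_zero _⟩,
      fun {W W'} ⟨r, h⟩ => ⟨-r, by rw [← h, rot_rot, neg_add_cancel, rot_zero]⟩,
      fun {W W' W''} ⟨r, h⟩ ⟨s, h'⟩ => ⟨s + r, by rw [← h', ← h, rot_rot]⟩⟩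

/-- The rotation classes of good squares. -/
def Necklace (v : ZMod p → α) := Quotient (rotSetoid v)

/-- The cyclic shift of the columns of good squares. -/
def shiftEquiv (v : ZMod p → α) : good v ≃ good v where
  toFun W := ⟨fun b => W.1 (b + 1), shift_mem_good W.2 1⟩
  invFun W := ⟨fun b => W.1 (b + -1), shift_mem_good W.2 (-1)⟩
  left_inv W := by ext; simp
  right_inv W := by ext; simp

namespace Necklace

variable {v : ZMod p → α}

/-- The class of a good square. -/
def mk (W : good v) : Necklace v := Quotient.mk (rotSetoid v) W

/-- A square representing a class. -/
noncomputable def rep (e : Necklace v) : good v := Quotient.out e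

@[simp] theorem mk_rep (e : Necklace v) : mk e.rep = e := Quotient.out_eq e

theorem mk_eq_mk {W W' : good v} : mk W = mk W' ↔ ∃ r, rot r W.1 = W'.1 := Quotient.eq

theorem eq_of_rot_rep_eq [Fact p.Prime] {e e' : Necklace v} {r r' : ZMod p}
    (h : rot r e.rep.1 = rot r' e'.rep.1) : e = e' ∧ r = r' := by
  have he : e = e' := by
    rw [← mk_rep e, ← mk_rep e', mk_eq_mk]
    refine ⟨-r' + r, ?_⟩
    rw [← rot_rot, h, rot_rot, neg_add_cancel, rot_zero]
  subst he
  exact ⟨rfl, eq_of_rot_eq e.rep.2 h⟩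

instance [NeZero p] [Finite α] : Finite (Necklace v) :=
  inferInstanceAs (Finite (Quotient (rotSetoid v)))

theorem card_mul [Fact p.Prime] : p * Nat.card (Necklace v) = (good v).ncard := by
  have : Function.Bijective fun x : ZMod p × Necklace v =>
      (⟨rot x.1 x.2.rep.1, rot_mem_good x.2.rep.2 x.1⟩ : good v) := by
    constructor
    · rintro ⟨r, e⟩ ⟨r', e'⟩ h
      obtain ⟨h1, h2⟩ := eq_of_rot_rep_eq (Subtype.ext_iff.1 h)
      exact Prod.ext h2 h1
    · intro W
      obtain ⟨r, hr⟩ := mk_eq_mk.1 (mk_rep (mk W))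
      exact ⟨(r, mk W), Subtype.ext hr⟩
  rw [← Nat.card_coe_set_eq, ← Nat.card_congr (Equiv.ofBijective _ this), Nat.card_prod,
    Nat.card_zmod]

/-- The permutation of the classes induced by the cyclic shift of the columns. -/
def shift (v : ZMod p → α) : Equiv.Perm (Necklace v) :=
  Quotient.congr (shiftEquiv v) fun W W' => by
    refine exists_congr fun r => ⟨fun h => ?_, fun h => ?_⟩
    · funext b
      exact congrFun h (b + 1)
    · funext b
      have := congrFun h (b + -1)
      simp only [shiftEquiv, Equiv.coe_fn_mk, neg_add_cancel_right] at this
      rw [← this]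
      funext a
      simp [rot]

theorem shift_mk (W : good v) : shift v (mk W) = mk (shiftEquiv v W) := rfl

/-- The squares of a class, each without its column `0`. -/
def tails (e : Necklace v) : Set ({b : ZMod p // b ≠ 0} → ZMod p → α) :=
  {t | ∃ W : good v, mk W = e ∧ ∀ b, t b = W.1 b}

theorem exists_of_tails_eq {W : good v} {e : Necklace v} (h : tails (mk W) = tails e) :
    ∃ W' : good v, mk W' = e ∧ ∀ b ≠ 0, W.1 b = W'.1 b := by
  have : (fun b => W.1 b.1) ∈ tails (mk W) := ⟨W, rfl, fun b => rfl⟩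
  rw [h] at this
  obtain ⟨W', h1, h2⟩ := this
  exact ⟨W', h1, fun b hb => h2 ⟨b, hb⟩⟩

theorem tails_subset {W W' : good v} (h : ∀ b ≠ 0, W.1 b = W'.1 b) :
    tails (mk W) ⊆ tails (mk W') := by
  rintro t ⟨U, hU, ht⟩
  obtain ⟨r, hr⟩ := mk_eq_mk.1 hU.symm
  refine ⟨⟨rot r W'.1, rot_mem_good W'.2 r⟩, (mk_eq_mk.2 ⟨r, rfl⟩).symm, fun b => ?_⟩
  rw [ht, ← hr]
  funext a
  simp [rot, h b.1 b.2]

/-- Classes with equal `tails` have representatives agreeing off column 0. Altering column 0 before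
the shift keeps the other columns, so successive classes overlap like windows, up to a rotation g.
-/
theorem exists_cycle [Fact p.Prime] [Finite α] {x y : α} (hxy : x ≠ y) :
    ∃ π : Equiv.Perm (Necklace (peak p x y)), (∀ e e', π.SameCycle e e') ∧
      ∀ e, ∃ g, ∀ b : ZMod p, b + 1 ≠ 0 → rot g (π e).rep.1 b = e.rep.1 (b + 1) := by
  obtain ⟨τ, hτ, hπ⟩ := exists_joined_perm tails (shift (peak p x y)) (by
    intro S hne hS htail
    -- Applied to a closed set and to its complement, this puts the same square in both.
    have key : ∀ S : Set (Necklace (peak p x y)), S.Nonempty →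
        (∀ e ∈ S, shift _ e ∈ S) → (∀ e ∈ S, ∀ e', tails e = tails e' → e' ∈ S) →
        Function.update (fun _ _ => x) 0 (peak p x y) ∈ Subtype.val '' (mk ⁻¹' S) := by
      intro S ⟨e, he⟩ hS htail
      refine connected hxy (by rintro _ ⟨W, -, rfl⟩; exact W.2) ?_ ?_
        ⟨e.rep, e.rep, by simp [he], rfl⟩
      · rintro _ ⟨W, hW, rfl⟩
        exact ⟨shiftEquiv _ W, hS _ hW, rfl⟩
      · rintro _ ⟨W, hW, rfl⟩ W' hW' h
        exact ⟨⟨W', hW'⟩, htail _ hW _ (Set.Subset.antisymm (tails_subset h)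
          (tails_subset fun b hb => (h b hb).symm)), rfl⟩
    by_contra hSu
    obtain ⟨W, hW, hWeq⟩ := key S hne hS htail
    obtain ⟨W', hW', hWeq'⟩ := key Sᶜ (Set.nonempty_compl.2 hSu) (fun e he he' => he (by
        have hsurj : ∀ m : ℕ, (shift (peak p x y) ^ m) (shift _ e) ∈ S := by
          intro m
          induction m with
          | zero => exact he'
          | succ m ih => rw [pow_succ']; exact hS _ ih
        obtain ⟨m, hm⟩ := (Equiv.Perm.sameCycle_apply_left.2
          (Equiv.Perm.SameCycle.refl (shift (peak p x y)) e)).exists_nat_pow_eq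
        exact hm ▸ hsurj m))
      fun e he e' h he' => he (htail e' he' e h.symm)
    rw [Subtype.ext (hWeq.trans hWeq'.symm)] at hW
    exact hW' hW)
  refine ⟨_, hπ, fun e => ?_⟩
  obtain ⟨W, hW, h⟩ := exists_of_tails_eq (W := e.rep) (e := τ e) (by rw [hτ, mk_rep])
  obtain ⟨g, hg⟩ := mk_eq_mk.1 (show mk ((shift (peak p x y) * τ) e).rep = mk (shiftEquiv _ W) by
    rw [mk_rep, Equiv.Perm.mul_apply, ← hW, shift_mk])
  refine ⟨g, fun b hb => ?_⟩
  rw [hg, h _ hb]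
  rfl

end Necklace

end CyclicSquare

/-! ### The strip with distinct windows. -/

open CyclicSquare in
/-- A cyclic array with `p` rows all of whose `p × p` windows are distinct. -/
theorem exists_strip (p : ℕ) [Fact p.Prime] {α : Type*} [Fintype α] [Nontrivial α] :
    ∃ (n : ℕ) (T : ZMod p → ℕ → α), p * n + Fintype.card α ^ p + p = Fintype.card α ^ p ^ 2 ∧
      (n : ZMod p) = -1 ∧ (∀ i j, T i (j + n) = T i j) ∧
      ∀ i j i' j', (∀ (a : ZMod p) (b : ℕ), b < p → T (i + a) (j + b) = T (i' + a) (j' + b)) →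
        i = i' ∧ j ≡ j' [MOD n] := by
  classical
  obtain ⟨x, y, hxy⟩ := exists_pair_ne α
  obtain ⟨π, hπ, hg⟩ := Necklace.exists_cycle (p := p) hxy
  choose g hg using hg
  have hp := (Fact.out : p.Prime)
  set n := Nat.card (Necklace (peak p x y)) with hn
  have hcard : p * n + Fintype.card α ^ p + p = Fintype.card α ^ p ^ 2 := by
    rw [hn, Necklace.card_mul, ncard_good hxy]
  have hn1 : (n : ZMod p) = -1 := by
    -- With q letters, q^p ≡ q mod p lifts to (q^p)^p ≡ q^p mod p², and the difference is p(n + 1).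
    have h1 : (Fintype.card α : ℤ) ^ p ≡ Fintype.card α [ZMOD p] :=
      (ZMod.intCast_eq_intCast_iff _ _ _).1 (by simp [ZMod.pow_card])
    have h2 : (p : ℤ) ^ 2 ∣ ((Fintype.card α : ℤ) ^ p) ^ p - (Fintype.card α : ℤ) ^ p := by
      have := dvd_sub_pow_of_dvd_sub (R := ℤ) (p := p) (h1.symm.dvd) 1
      simpa using this
    have h3 : ((Fintype.card α : ℤ) ^ p) ^ p - (Fintype.card α : ℤ) ^ p = p * (n + 1) := by
      rw [← pow_mul, ← sq]
      have : (p * n + Fintype.card α ^ p + p : ℤ) = (Fintype.card α : ℤ) ^ p ^ 2 := by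
        exact_mod_cast hcard
      linarith
    rw [h3, sq] at h2
    have h4 : (p : ℤ) ∣ n + 1 :=
      Int.dvd_of_mul_dvd_mul_left (by exact_mod_cast hp.ne_zero) h2
    have h5 := (ZMod.intCast_zmod_eq_zero_iff_dvd _ p).2 h4
    push_cast at h5
    exact eq_neg_of_add_eq_zero_left h5
  have hne : Nonempty (Necklace (peak p x y)) := by
    by_contra hc
    rw [not_nonempty_iff] at hc
    rw [hn, Nat.card_of_isEmpty] at hn1
    simp at hn1
  obtain ⟨e₀⟩ := hne
  have := Fintype.ofFinite (Necklace (peak p x y))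
  have hcyc : π.IsCycleOn ((Finset.univ : Finset (Necklace (peak p x y))) : Set _) :=
    ⟨by simp, fun e _ e' _ => hπ e e'⟩
  have hcu : (Finset.univ : Finset (Necklace (peak p x y))).card = n := by
    rw [hn, Nat.card_eq_fintype_card, Finset.card_univ]
  set e : ℕ → Necklace (peak p x y) := fun j => (π ^ j) e₀ with he
  have heq : ∀ j j', e j = e j' → j ≡ j' [MOD n] := fun j j' h => by
    rw [← hcu]
    exact (hcyc.pow_apply_eq_pow_apply (Finset.mem_univ e₀)).1 h
  have hper : ∀ j j', j ≡ j' [MOD n] → e j = e j' := fun j j' h => by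
    rw [← hcu] at h
    exact (hcyc.pow_apply_eq_pow_apply (Finset.mem_univ e₀)).2 h
  have hpern : ∀ j, e (j + n) = e j := fun j => hper _ _ (by simp [Nat.ModEq])
  -- Accumulated rotations, making successive squares `W j` overlap exactly.
  set G : ℕ → ZMod p := fun j => ∑ i ∈ Finset.range j, g (e i) with hG
  have hGn : ∀ j, G (j + n) = G j + G n := by
    intro j
    simp only [hG]
    rw [add_comm j n, Finset.sum_range_add, add_comm]
    congr 1
    exact Finset.sum_congr rfl fun i _ => by rw [add_comm n, hpern]
  set W : ℕ → CyclicSquare p α := fun j => rot (G j) (e j).rep.1 with hW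
  have hstep : ∀ j (b : ZMod p), b + 1 ≠ 0 → W (j + 1) b = W j (b + 1) := by
    intro j b hb
    have h1 : e (j + 1) = π (e j) := by simp only [he, pow_succ', Equiv.Perm.mul_apply]
    have h2 := hg (e j) b hb
    have h3 : W (j + 1) = rot (G j) (rot (g (e j)) (π (e j)).rep.1) := by
      simp only [hW, rot_rot, h1]
      congr 1
      simp only [hG, Finset.sum_range_succ]
    rw [h3]
    funext a
    simp only [hW]
    rw [rot, h2, rot]
  have hwin : ∀ b : ℕ, b < p → ∀ j, W (j + b) 0 = W j b := by
    intro b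
    induction b with
    | zero => simp
    | succ b ih =>
      intro hb j
      have h0 : ((b : ZMod p) + 1) ≠ 0 := by
        intro h0
        have : ((b + 1 : ℕ) : ZMod p) = 0 := by exact_mod_cast h0
        exact absurd (Nat.le_of_dvd (Nat.succ_pos b) ((ZMod.natCast_eq_zero_iff _ _).1 this))
          (not_le.2 hb)
      rw [show j + (b + 1) = (j + 1) + b by ring, ih (by omega), hstep j b h0]
      push_cast
      rfl
  set c := G n with hc
  set T : ZMod p → ℕ → α := fun i j => W j 0 (i + c * j) with hT
  -- The drift G(j + n) = G(j) + c is offset by c(j + n) = cj − c in ℤ/p.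
  have hF : ∀ j j', j ≡ j' [MOD n] → G j + c * j = G j' + c * j' := by
    have h1 : ∀ j q : ℕ, G (j + n * q) + c * (j + n * q : ℕ) = G j + c * j := by
      intro j q
      induction q with
      | zero => simp
      | succ q ih =>
        rw [← ih, show j + n * (q + 1) = (j + n * q) + n by ring, hGn]
        push_cast [hn1]
        ring
    intro j j' h
    rw [← Nat.mod_add_div j n, ← Nat.mod_add_div j' n, h1, h1, h]
  refine ⟨n, T, hcard, hn1, fun i j => ?_, fun i j i' j' h => ?_⟩
  · have h1 := hF (j + n) j (by simp [Nat.ModEq])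
    simp only [hT, hW, rot, hpern]
    refine congrArg _ ?_
    linear_combination h1
  · have h1 : ∀ (a : ZMod p) (b : ZMod p),
        W j b (i + a + c * (j + b)) = W j' b (i' + a + c * (j' + b)) := by
      intro a b
      have h2 := h a b.val b.val_lt
      simp only [hT, hwin _ b.val_lt] at h2
      simpa using h2
    have h2 : rot (i + c * (j : ZMod p)) (W j) = rot (i' + c * (j' : ZMod p)) (W j') := by
      funext b a
      -- The row offset a − cb undoes the shear inside the window.
      have := h1 (a - c * b) b
      simp only [rot]
      convert this using 2 <;> ring
    simp only [hW, rot_rot] at h2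
    obtain ⟨h3, h4⟩ := Necklace.eq_of_rot_rep_eq h2
    have h5 := heq _ _ h3
    refine ⟨?_, h5⟩
    linear_combination h4 - hF _ _ h5

/-! ### The value of N and the square array. -/

theorem mul_necklaceM_prime {p : ℕ} (hp : p.Prime) (q : ℕ) :
    (p : ℚ) * necklaceM q p = (q : ℚ) ^ p - q := by
  have h0 : (p : ℚ) ≠ 0 := by exact_mod_cast hp.ne_zero
  rw [necklaceM, hp.sum_divisors, Nat.div_self hp.pos, Nat.div_one,
    ArithmeticFunction.moebius_apply_prime hp]
  simp
  field_simp
  ring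

theorem theorem4 (k p : ℕ) (hk : 2 ≤ k) (hp : p.Prime)
    (Γ : Type*) [Fintype Γ] (hΓ : Fintype.card Γ = k ^ 2) :
    ∃ N : ℕ,
      (N : ℚ) = (p : ℚ) * (necklaceM (k ^ p) p - 1) ∧
      (N : ℤ) = (k : ℤ) ^ (p ^ 2) - (k : ℤ) ^ p - (p : ℤ) ∧
      ∃ A : Matrix (Fin N) (Fin N) Γ, IsSubPerfectMap N N p p (k ^ 2) A := by
  have : Fact p.Prime := ⟨hp⟩
  have : NeZero k := ⟨by omega⟩
  have : Nontrivial (Fin k) := Fin.nontrivial_iff_two_le.2 hk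
  obtain ⟨n, T, hcard, hn, hper, hinj⟩ := exists_strip p (α := Fin k)
  rw [Fintype.card_fin] at hcard
  have hcop : p.Coprime n := by
    rw [hp.coprime_iff_not_dvd]
    intro h
    rw [(ZMod.natCast_eq_zero_iff _ _).2 h] at hn
    simp at hn
  have φ : Fin k × Fin k ≃ Γ := Fintype.equivOfCardEq (by simp [hΓ, sq])
  have hperm : ∀ i (j q : ℕ), T i (j + n * q) = T i j := by
    intro i j q
    induction q with
    | zero => rfl
    | succ q ih => rw [mul_add, mul_one, ← add_assoc, hper, ih]
  have hmod : ∀ i j : ℕ, T ((i % (p * n) : ℕ) : ZMod p) (j % (p * n)) = T i j := by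
    intro i j
    have h1 : ((i % (p * n) : ℕ) : ZMod p) = i := by
      rw [ZMod.natCast_eq_natCast_iff]
      exact (Nat.mod_modEq i (p * n)).of_dvd (Dvd.intro _ rfl)
    have h2 : T i j = T i (j % (p * n) + n * (p * (j / (p * n)))) := by
      congr 1
      rw [← mul_assoc, mul_comm n p, Nat.mod_add_div]
    rw [h1, h2, hperm]
  refine ⟨p * n, ?_, ?_, fun i j => φ (T (i : ℕ) j, T (j : ℕ) i), hΓ, ?_⟩
  · rw [mul_sub, mul_necklaceM_prime hp]
    have : (p * n + k ^ p + p : ℚ) = (k : ℚ) ^ p ^ 2 := by exact_mod_cast hcard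
    push_cast
    rw [← pow_mul, ← sq]
    linarith
  · have : (p * n + k ^ p + p : ℤ) = (k : ℤ) ^ p ^ 2 := by exact_mod_cast hcard
    push_cast
    linarith
  · rintro P ⟨i, j⟩ h ⟨i', j'⟩ h'
    have key : ∀ a b : ℕ, a < p → b < p →
        T ((i + a : ℕ) : ZMod p) (j + b) = T ((i' + a : ℕ) : ZMod p) (j' + b) ∧
        T ((j + b : ℕ) : ZMod p) (i + a) = T ((j' + b : ℕ) : ZMod p) (i' + a) := by
      intro a b ha hb
      have h1 := φ.injective ((h ⟨a, ha⟩ ⟨b, hb⟩).trans (h' ⟨a, ha⟩ ⟨b, hb⟩).symm)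
      simpa only [cyclicStep, hmod, Prod.mk.injEq] using h1
    obtain ⟨h1, h2⟩ := hinj i j i' j' fun a b hb => by
      simpa using (key a.val b a.val_lt hb).1
    obtain ⟨h3, h4⟩ := hinj j i j' i' fun b a ha => by
      simpa using (key a b.val ha b.val_lt).2
    rw [ZMod.natCast_eq_natCast_iff] at h1 h3
    have hi := (Nat.modEq_and_modEq_iff_modEq_mul hcop).1 ⟨h1, h4⟩
    have hj := (Nat.modEq_and_modEq_iff_modEq_mul hcop).1 ⟨h3, h2⟩
    exact Prod.ext (Fin.ext (hi.eq_of_lt_of_lt i.2 i'.2)) (Fin.ext (hj.eq_of_lt_of_lt j.2 j'.2))
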